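/- **Setting.** Let $G$ be a countable infinite group and let $\Gamma_1\supseteq\Gamma_2\supseteq\cdots$ be normal subgroups of finite index in $G$ with $\bigcap_{n\ge1}\Gamma_n=\{1_G\}$. Let $D_1\subseteq D_2\subseteq\cdots$ be finite subsets of $G$ with $1_G\in D_n$ for all $n$ and $\bigcup_n D_n=G$, such that $D_n$ contains exactly one element of every coset in $G/\Gamma_n$, and $D_j=\bigcup_{v\in D_j\cap\Gamma_i}vD_i$ for all $j>i\ge1$. Assume that $L=\frac1{|D_1|}+\sum_{j\ge1}\frac{|D_j|}{|D_{j+1}|}$ converges and that $1-e^{-2L}<\frac14$. Put $J(0)=\{1_G\}$ and $J(n)=D_n\setminus\bigcup_{i=0}^{n-1}J(i)\Gamma_{i+1}$ for $n\ge1$, and let $m(i)=|J(i)|$ and $m_k=1+k+\sum_{i=0}^k m(i)$ for $i,k\ge0$. For every $k\ge1$ fix an enumeration $J(k)=\{g^k_1,\dots,g^k_{m(k)}\}$ and, for $0\le s'<m(k)$, an element $h^k_{s'+1}\in J(m_{k-1}+s')\cap g^k_{s'+1}\Gamma_k$. Assume that $v^{-1}h^k_{m(k)}\in D_{m_k}$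 for all $k\ge1$ and all $v\in(\Gamma_{m_k-2}\cap D_{m_k-1})\setminus\{1_G\}$. The sets $d\,\Gamma_{s+1}$ ($s\ge0$, $d\in J(s)$) form a partition of $G$. Define $\eta\in\{0,1\}^G$ to be constant on each of them: $\eta=1$ on $\Gamma_1$ (the case $s=0$); if $s=m_{k-1}+s'$ with $k\ge1$ and $0\le s'<m(k)$, then $\eta=1$ on $h^k_{s'+1}\Gamma_{s+1}$ and $\eta=0$ on $d\,\Gamma_{s+1}$ for the other $d\in J(s)$; and if $s+1=m_k$ for some $k\ge0$, then $\eta=0$ on $d\,\Gamma_{s+1}$ for all $d\in J(s)$. Let $X=\overline{O_\sigma(\eta)}$ be the closure of the orbit of $\eta$ under the shift $(\sigma^gx)(h)=x(g^{-1}h)$. For $x\in\{0,1\}^G$ and $\alpha\in\{0,1\}$ let $\mathrm{Per}(x,\Gamma_n,\alpha)=\{g: x(\gamma g)=\alpha\ \text{for all}\ \gamma\in\Gamma_n\}$, and let $C_n=\{x\in X:\mathrm{Per}(x,\Gamma_n,\alpha)=\mathrm{Per}(\eta,\Gamma_n,\alpha)\text{ for }\alpha=0,1\}$. Let $\overleftarrow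 G=\varprojlim G/\Gamma_n$ be the $G$-odometer, with $G$ acting by left multiplication in every coordinate. An invariant measure is an invariant Borel probability measure. **Proposition (Conjugacy).** There is a map $\pi:X\to\overleftarrow G$ with $\pi(x)=(g_n\Gamma_n)_{n}$, where $g_n\Gamma_n$ is the only coset such that $x\in\sigma^{g_n}C_n$. For every invariant measure $\mu'$ of $X$, the map $\pi$ is a measure conjugacy of $(X,\mu')$ and $(\overleftarrow G,\nu)$, where $\nu$ is the unique invariant measure of $\overleftarrow G$; that is, $\pi$ is a factor map (continuous, surjective and equivariant), and there are invariant Borel sets $X'\subseteq X$ and $Y'\subseteq\overleftarrow G$ with $\mu'(X')=1=\nu(Y')$ such that $\pi|_{X'}:X'\to Y'$ is a bimeasurable bijection that carries $\mu'$ to $\nu$. Moreover, there is an invariant Borel set $A\subseteq X$ on which $\pi$ is injective and which has $\mu'(A)=1$ for every invariant measure $\mu'$ of $X$. -/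

import Mathlib

open MeasureTheory

/-! # Generic notions for group actions on topological spaces -/

namespace Toeplitz

section Dynamics

variable (G : Type*) [Group G]
variable {X Y : Type*} [MulAction G X] [MulAction G Y]

/-- A factor map between two `G`-spaces: continuous, surjective and equivariant. -/
structure IsFactorMap [TopologicalSpace X] [TopologicalSpace Y] (π : X → Y) : Prop where
  continuous : Continuous π
  surjective : Function.Surjective π
  equivariant : ∀ (g : G) (x : X), π (g • x) = g • π x

/-- An invariant measure of a `G`-space: an invariant Borel probability measure. -/
structure IsInvariantMeasure [MeasurableSpace X] (μ : Measure X) : Prop where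
  isProbabilityMeasure : IsProbabilityMeasure μ
  invariant : ∀ (g : G) (A : Set X), MeasurableSet A → μ ((fun x => g • x) '' A) = μ A

/-- A set that is mapped onto itself by every element of `G`. -/
def IsInvariantSet (A : Set X) : Prop :=
  ∀ g : G, (fun x => g • x) '' A = A

/-- `π` is a measure conjugacy of `μ` and `ν`: it is a factor map, and it restricts to a bimeasurable
bijection between invariant Borel sets of full measure that carries `μ` to `ν`. -/
structure IsMeasureConjugacy [TopologicalSpace X] [TopologicalSpace Y]
    [MeasurableSpace X] [MeasurableSpace Y] (π : X → Y) (μ : Measure X) (ν : Measure Y) :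
    Prop where
  isFactorMap : IsFactorMap G π
  exists_restriction : ∃ (X' : Set X) (Y' : Set Y),
    MeasurableSet X' ∧ IsInvariantSet G X' ∧ μ X'ᶜ = 0 ∧
    MeasurableSet Y' ∧ IsInvariantSet G Y' ∧ ν Y'ᶜ = 0 ∧
    ∃ e : X' ≃ᵐ Y', (∀ x : X', (e x : Y) = π x) ∧
      MeasurePreserving e (μ.comap Subtype.val) (ν.comap Subtype.val)

end Dynamics

variable {G : Type*} [Group G]

/-! # Odometers -/

/-- The inverse limit of the coset spaces `G ⧸ Γ n` of a sequence of subgroups, along the canonical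
maps: `x (n + 1) = gΓ (n + 1)` forces `x n = gΓ n`. -/
def Odometer (Γ : ℕ → Subgroup G) : Type _ :=
  {x : (n : ℕ) → G ⧸ Γ n // ∀ (n : ℕ) (g : G), x (n + 1) = (g : G ⧸ Γ (n + 1)) →
    x n = (g : G ⧸ Γ n)}

/-- The topology induced by the product of the discrete topologies. -/
instance (Γ : ℕ → Subgroup G) : TopologicalSpace (Odometer Γ) :=
  TopologicalSpace.induced Subtype.val (@Pi.topologicalSpace ℕ (fun n => G ⧸ Γ n) fun _ => ⊥)

instance (Γ : ℕ → Subgroup G) : MeasurableSpace (Odometer Γ) := borel _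

instance (Γ : ℕ → Subgroup G) : BorelSpace (Odometer Γ) := ⟨rfl⟩

/-- The action of `G` by left multiplication in every coordinate. -/
instance (Γ : ℕ → Subgroup G) : MulAction G (Odometer Γ) where
  smul g x := ⟨fun n => g • x.1 n, fun n a h => by
    have h' : x.1 (n + 1) = ((g⁻¹ * a : G) : G ⧸ Γ (n + 1)) := by
      have h0 : g • x.1 (n + 1) = (a : G ⧸ Γ (n + 1)) := h
      rw [← smul_eq_mul, ← MulAction.Quotient.smul_coe, ← h0, inv_smul_smul]
    have h'' : g • x.1 n = g • ((g⁻¹ * a : G) : G ⧸ Γ n) := congrArg (g • ·) (x.2 n _ h')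
    exact h''.trans (by rw [MulAction.Quotient.smul_coe, smul_eq_mul, mul_inv_cancel_left])⟩
  one_smul x := Subtype.ext (funext fun n => one_smul G (x.1 n))
  mul_smul a b x := Subtype.ext (funext fun n => mul_smul a b (x.1 n))

/-! # Arrays over `G`, the shift, orbit closures and periods -/

/-- The left shift `(σ^g x)(h) = x (g⁻¹ h)`. -/
def shift {S : Type*} (g : G) (x : G → S) : G → S := fun h => x (g⁻¹ * h)

/-- The closure of the shift orbit of `η` in the full shift over the symbols `0` and `1`. -/
def orbitClosure (η : G → Fin 2) : Set (G → Fin 2) :=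
  closure (Set.range fun g : G => shift g η)

theorem continuous_shift (g : G) : Continuous (shift g : (G → Fin 2) → G → Fin 2) :=
  continuous_pi fun h => continuous_apply (g⁻¹ * h)

theorem shift_shift {S : Type*} (a b : G) (x : G → S) : shift (a * b) x = shift a (shift b x) := by
  funext h
  simp [shift, mul_assoc]

theorem shift_mem_orbitClosure (η : G → Fin 2) (g : G) {x : G → Fin 2}
    (hx : x ∈ orbitClosure η) : shift g x ∈ orbitClosure η :=
  map_mem_closure (continuous_shift g) hx (by
    rintro _ ⟨a, rfl⟩
    exact ⟨g * a, shift_shift g a η⟩)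

/-- The shift action on the orbit closure. -/
instance (η : G → Fin 2) : MulAction G (orbitClosure η) where
  smul g x := ⟨shift g x.1, shift_mem_orbitClosure η g x.2⟩
  one_smul x := Subtype.ext (funext fun h => by
    change x.1 (1⁻¹ * h) = x.1 h
    simp)
  mul_smul a b x := Subtype.ext (shift_shift a b x.1)

/-- `Per(x, H, α)`: the positions `g` such that `x` takes the value `α` on all of `Hg`. -/
def per (x : G → Fin 2) (H : Subgroup G) (α : Fin 2) : Set G :=
  {g | ∀ γ ∈ H, x (γ * g) = α}

/-- The elements of the orbit closure of `η` that have the same `H`-periodic part as `η`. -/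
def samePeriodicPart (η : G → Fin 2) (H : Subgroup G) : Set (orbitClosure η) :=
  {x | ∀ α : Fin 2, per x.1 H α = per η H α}

/-- The description of the canonical map of the orbit closure of `η` to the odometer:
`π(x)` is the sequence of the cosets `gΓ n` such that `x ∈ σ^g C_n`, where `C_n` is the set of points
with the same `Γ n`-periodic part as `η`. -/
def IsCanonicalMap (η : G → Fin 2) (Γ : ℕ → Subgroup G) (π : orbitClosure η → Odometer Γ) : Prop :=
  ∀ (x : orbitClosure η) (n : ℕ) (g : G),
    (π x).1 n = (g : G ⧸ Γ n) ↔ ∃ y ∈ samePeriodicPart η (Γ n), x = g • y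

/-! # The construction

The sequences `Γ` and `D` are indexed from `1`; their entries at `0` are never used. -/

/-- A decreasing sequence `Γ 1, Γ 2, …` of normal subgroups of finite index with trivial
intersection, with an exhausting and compatible sequence of fundamental domains `D 1, D 2, …`. -/
structure IsFundamentalSequence (Γ : ℕ → Subgroup G) (D : ℕ → Finset G) : Prop where
  normal : ∀ n, 1 ≤ n → (Γ n).Normal
  finiteIndex : ∀ n, 1 ≤ n → (Γ n).FiniteIndex
  decreasing : ∀ n, 1 ≤ n → Γ (n + 1) ≤ Γ n
  trivial_inter : ∀ g : G, (∀ n, 1 ≤ n → g ∈ Γ n) → g = 1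
  one_mem : ∀ n, 1 ≤ n → (1 : G) ∈ D n
  subset_succ : ∀ n, 1 ≤ n → D n ⊆ D (n + 1)
  existsUnique_mem_coset : ∀ n, 1 ≤ n → ∀ g : G, ∃! d, d ∈ D n ∧ d⁻¹ * g ∈ Γ n
  exhausts : ∀ g : G, ∃ n, 1 ≤ n ∧ g ∈ D n
  mem_iff : ∀ i j, 1 ≤ i → i < j → ∀ g : G,
    g ∈ D j ↔ ∃ v ∈ D j, v ∈ Γ i ∧ ∃ d ∈ D i, g = v * d

/-- The series `L = 1/|D 1| + |D 1|/|D 2| + |D 2|/|D 3| + ⋯` converges and `1 - exp (-2L) < 1/4`. -/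
structure IsRapidlyGrowing (D : ℕ → Finset G) : Prop where
  summable : Summable fun j : ℕ => ((D (j + 1)).card : ℝ) / ((D (j + 2)).card : ℝ)
  bound : 1 - Real.exp (-2 * (1 / ((D 1).card : ℝ) +
    ∑' j : ℕ, ((D (j + 1)).card : ℝ) / ((D (j + 2)).card : ℝ))) < 1 / 4

/-- `J(0) = {1}` and `J(n) = D n \ ⋃ i < n, J(i) Γ (i + 1)` for `n ≥ 1`. -/
def J (Γ : ℕ → Subgroup G) (D : ℕ → Finset G) : ℕ → Set G
  | 0 => {1}
  | n + 1 => {x | x ∈ D (n + 1) ∧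
      ∀ (i : ℕ) (_ : i < n + 1), ∀ g ∈ J Γ D i, g⁻¹ * x ∉ Γ (i + 1)}
termination_by n => n
decreasing_by omega

/-- `m(i) = |J(i)|`; the set `J(i)` is finite. -/
noncomputable def m (Γ : ℕ → Subgroup G) (D : ℕ → Finset G) (i : ℕ) : ℕ := (J Γ D i).ncard

/-- `m_k = 1 + k + m(0) + ⋯ + m(k)`. -/
noncomputable def mSum (Γ : ℕ → Subgroup G) (D : ℕ → Finset G) (k : ℕ) : ℕ :=
  1 + k + ∑ i ∈ Finset.range (k + 1), m Γ D i

/-- The choices made in the construction: for every `k ≥ 1`, an enumeration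
`J(k) = {enum k 1, …, enum k m(k)}`, and for `0 ≤ s' < m(k)` an element
`h k (s' + 1)` of `J(m_{k-1} + s') ∩ (enum k (s' + 1)) Γ k`. -/
structure IsChoice (Γ : ℕ → Subgroup G) (D : ℕ → Finset G) (enum h : ℕ → ℕ → G) : Prop where
  enum_bijOn : ∀ k, 1 ≤ k → Set.BijOn (enum k) (Set.Icc 1 (m Γ D k)) (J Γ D k)
  mem_J : ∀ k s', 1 ≤ k → s' < m Γ D k → h k (s' + 1) ∈ J Γ D (mSum Γ D (k - 1) + s')
  mem_coset : ∀ k s', 1 ≤ k → s' < m Γ D k → (enum k (s' + 1))⁻¹ * h k (s' + 1) ∈ Γ k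

/-- For every `k ≥ 1` and every `v ≠ 1` in `Γ (m_k - 2) ∩ D (m_k - 1)`, the element
`v⁻¹ h k m(k)` lies in `D m_k`. -/
def IsLinked (Γ : ℕ → Subgroup G) (D : ℕ → Finset G) (h : ℕ → ℕ → G) : Prop :=
  ∀ k, 1 ≤ k → ∀ v ∈ D (mSum Γ D k - 1), v ∈ Γ (mSum Γ D k - 2) → v ≠ 1 →
    v⁻¹ * h k (m Γ D k) ∈ D (mSum Γ D k)

/-- The elements `d` of `J(s)` for which step `s + 1` puts the symbol `1` on `d Γ (s + 1)`:
the only element of `J(0)` if `s = 0`, the element `h k (s' + 1)` if `s = m_{k-1} + s'` with `k ≥ 1`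
and `0 ≤ s' < m(k)`, and none otherwise (that is, if `s + 1 = m_k` for some `k ≥ 0`). -/
def IsMarked (Γ : ℕ → Subgroup G) (D : ℕ → Finset G) (h : ℕ → ℕ → G) (s : ℕ) (d : G) : Prop :=
  s = 0 ∨ ∃ k s', 1 ≤ k ∧ s' < m Γ D k ∧ s = mSum Γ D (k - 1) + s' ∧ d = h k (s' + 1)

open Classical in
/-- The constructed array: for every `s ≥ 0` and `d ∈ J(s)`, it is constant on `d Γ (s + 1)`, with
value `1` if `d` is marked at step `s + 1` and `0` otherwise. -/
noncomputable def array (Γ : ℕ → Subgroup G) (D : ℕ → Finset G) (h : ℕ → ℕ → G) : G → Fin 2 :=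
  fun x => if ∃ s, ∃ d ∈ J Γ D s, d⁻¹ * x ∈ Γ (s + 1) ∧ IsMarked Γ D h s d then 1 else 0

/-- The sets `d Γ (s + 1)`, `d ∈ J(s)`, `s ≥ 0`, are pairwise disjoint. -/
theorem J_coset_unique {Γ : ℕ → Subgroup G} {D : ℕ → Finset G} (hΓ : IsFundamentalSequence Γ D)
    {s t : ℕ} {d e x : G} (hd : d ∈ J Γ D s) (he : e ∈ J Γ D t)
    (hdx : d⁻¹ * x ∈ Γ (s + 1)) (hex : e⁻¹ * x ∈ Γ (t + 1)) : s = t ∧ d = e := by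
  have anti : ∀ a b, 1 ≤ a → a ≤ b → Γ b ≤ Γ a := by
    intro a b ha hab
    induction hab with
    | refl => exact le_rfl
    | step hle ih => exact (hΓ.decreasing _ (ha.trans hle)).trans ih
  have key : ∀ {s t : ℕ} {d e : G}, d ∈ J Γ D s → e ∈ J Γ D t → d⁻¹ * x ∈ Γ (s + 1) →
      e⁻¹ * x ∈ Γ (t + 1) → ¬ s < t := by
    intro s t d e hd he hdx hex hst
    obtain ⟨t, rfl⟩ : ∃ t', t = t' + 1 := ⟨t - 1, by omega⟩
    rw [J, Set.mem_ofPred_eq] at he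
    apply he.2 s hst d hd
    have := (Γ (s + 1)).mul_mem hdx
      ((Γ (s + 1)).inv_mem (anti (s + 1) (t + 1 + 1) (by omega) (by omega) hex))
    simpa [mul_assoc] using this
  have hst : s = t := le_antisymm (not_lt.1 (key he hd hex hdx)) (not_lt.1 (key hd he hdx hex))
  subst hst
  refine ⟨rfl, ?_⟩
  rcases s with _ | s
  · rw [J, Set.mem_singleton_iff] at hd he
    rw [hd, he]
  · rw [J, Set.mem_ofPred_eq] at hd he
    have hle := hΓ.decreasing (s + 1) (by omega)
    exact (hΓ.existsUnique_mem_coset (s + 1) (by omega) x).unique ⟨hd.1, hle hdx⟩ ⟨he.1, hle hex⟩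

/-- The sets `d Γ (s + 1)`, `d ∈ J(s)`, `s ≥ 0`, cover the group. -/
theorem exists_mem_J_coset {Γ : ℕ → Subgroup G} {D : ℕ → Finset G}
    (hΓ : IsFundamentalSequence Γ D) (x : G) :
    ∃ s, ∃ d ∈ J Γ D s, d⁻¹ * x ∈ Γ (s + 1) := by
  obtain ⟨n, hn, hx⟩ := hΓ.exhausts x
  obtain ⟨n, rfl⟩ : ∃ n', n = n' + 1 := ⟨n - 1, by omega⟩
  by_cases hJ : x ∈ J Γ D (n + 1)
  · exact ⟨n + 1, x, hJ, by simp [(Γ (n + 1 + 1)).one_mem]⟩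
  · rw [J, Set.mem_ofPred_eq, not_and] at hJ
    have := hJ hx
    push Not at this
    obtain ⟨i, -, d, hd, hm⟩ := this
    exact ⟨i, d, hd, hm⟩

open Classical in
/-- The array takes the value that step `s + 1` of the construction prescribes. -/
theorem array_apply {Γ : ℕ → Subgroup G} {D : ℕ → Finset G} (hΓ : IsFundamentalSequence Γ D)
    (h : ℕ → ℕ → G) {s : ℕ} {d γ : G} (hd : d ∈ J Γ D s) (hγ : γ ∈ Γ (s + 1)) :
    array Γ D h (d * γ) = if IsMarked Γ D h s d then 1 else 0 := by
  have hiff : (∃ t, ∃ e ∈ J Γ D t, e⁻¹ * (d * γ) ∈ Γ (t + 1) ∧ IsMarked Γ D h t e) ↔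
      IsMarked Γ D h s d := by
    constructor
    · rintro ⟨t, e, he, hm, hk⟩
      obtain ⟨rfl, rfl⟩ := J_coset_unique hΓ hd he (by simpa using hγ) hm
      exact hk
    · intro hk
      exact ⟨s, d, hd, by simpa using hγ, hk⟩
  simp only [array, hiff]

end Toeplitz

open MeasureTheory

namespace Toeplitz

variable {G : Type*} [Group G]

/-! ### Open positions and their cosets. -/

section Fundamental

variable {Γ : ℕ → Subgroup G} {D : ℕ → Finset G}

/-! A point of `X` over a given point of the odometer has prescribed symbols at its periodic
positions, so `π` can only fail to be injective through nonperiodic symbols. Points with no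
nonperiodic `1` are therefore determined by their image (`injOn_periodicOnes`), and these points
form the set `A`. What remains is that nonperiodic `1`s are null for every invariant measure.

This follows from sparsity (`eq_of_array_eq_one`): a translate of `D n` by an element of `Γ n` has
at most one `1` among its open positions. The reason is that the open positions of such a tile that
are still unfilled when one of them gets its symbol are all filled within a single tile of that
step, and each step after the first marks at most one element of `J s`. Sparsity passes to the
limits in `X` over the identity coset. Translating a nonperiodic `1` at the identity back to that
fibre gives disjoint events inside a set of mass `1 / [G : Γ n]` (`measure_le`); the indices tend to
infinity, and invariance handles the other positions.

The map `π` exists because `Γ n` contains every translation preserving the `Γ n`-periodic part of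
the array (`mem_of_per_subset`), and because the closures of the translates along the finitely many
cosets of `Γ n` cover `X` and have translated periodic parts (`mem_per_iff`). The odometer has only
one invariant measure, so it is the image of any invariant measure of `X`; the Lusin–Souslin theorem
makes the injective restriction of `π` bimeasurable. -/

theorem IsFundamentalSequence.le_of_le (hΓ : IsFundamentalSequence Γ D) {a b : ℕ} (ha : 1 ≤ a)
    (hab : a ≤ b) : Γ b ≤ Γ a := by
  induction hab with
  | refl => exact le_rfl
  | step hle ih => exact (hΓ.decreasing _ (ha.trans hle)).trans ih

theorem IsFundamentalSequence.mul_mem_comm (hΓ : IsFundamentalSequence Γ D) {n : ℕ} (hn : 1 ≤ n)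
    {a b : G} : a * b ∈ Γ n ↔ b * a ∈ Γ n :=
  (hΓ.normal n hn).mem_comm_iff

/-- Left multiplication by elements of a normal subgroup does not change the coset. -/
theorem IsFundamentalSequence.inv_mul_mul_mem_iff (hΓ : IsFundamentalSequence Γ D) {n : ℕ}
    (hn : 1 ≤ n) {a b v : G} (hv : v ∈ Γ n) : a⁻¹ * (v * b) ∈ Γ n ↔ a⁻¹ * b ∈ Γ n := by
  rw [hΓ.mul_mem_comm hn, mul_assoc, (Γ n).mul_mem_cancel_left hv, hΓ.mul_mem_comm hn]

theorem IsFundamentalSequence.eq_of_mem (hΓ : IsFundamentalSequence Γ D) {n : ℕ} (hn : 1 ≤ n)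
    {a b : G} (ha : a ∈ D n) (hb : b ∈ D n) (hab : a⁻¹ * b ∈ Γ n) : a = b :=
  (hΓ.existsUnique_mem_coset n hn b).unique ⟨ha, hab⟩ ⟨hb, by simp [(Γ n).one_mem]⟩

theorem J_subset {s : ℕ} (hs : 1 ≤ s) {d : G}
    (hd : d ∈ J Γ D s) : d ∈ D s := by
  obtain ⟨s, rfl⟩ : ∃ s', s = s' + 1 := ⟨s - 1, by omega⟩
  rw [J, Set.mem_ofPred_eq] at hd
  exact hd.1

/-- The positions that the first `n` steps of the construction leave open. -/
def hole (Γ : ℕ → Subgroup G) (D : ℕ → Finset G) (n : ℕ) : Set G :=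
  {x | ∀ i < n, ∀ d ∈ J Γ D i, d⁻¹ * x ∉ Γ (i + 1)}

theorem mem_J_iff {s : ℕ} (hs : 1 ≤ s) {d : G} : d ∈ J Γ D s ↔ d ∈ D s ∧ d ∈ hole Γ D s := by
  obtain ⟨s, rfl⟩ : ∃ s', s = s' + 1 := ⟨s - 1, by omega⟩
  rw [J, Set.mem_ofPred_eq]
  rfl

theorem hole_mono {s t : ℕ} (hst : s ≤ t) : hole Γ D t ⊆ hole Γ D s :=
  fun _ hx i hi d hd => hx i (hi.trans_le hst) d hd

theorem J_coset_fibre (hΓ : IsFundamentalSequence Γ D) {s : ℕ} (hs : 1 ≤ s) {d e : G}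
    (hd : d ∈ J Γ D s) (he : e ∈ J Γ D s) (hde : d⁻¹ * e ∈ Γ s) : d = e :=
  hΓ.eq_of_mem hs (J_subset hs hd) (J_subset hs he) hde

/-- Each coset filled in the first `n` steps is a coset of a normal subgroup containing `Γ n`, hence
is a union of cosets of `Γ n`. -/
theorem mul_mem_hole_iff (hΓ : IsFundamentalSequence Γ D) {n : ℕ} {v x : G}
    (hv : v ∈ Γ n) : v * x ∈ hole Γ D n ↔ x ∈ hole Γ D n := by
  refine forall₂_congr fun i hi => forall₂_congr fun d _ => not_congr ?_
  exact hΓ.inv_mul_mul_mem_iff (by omega) (hΓ.le_of_le (by omega) (by omega : i + 1 ≤ n) hv)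

theorem mem_hole_of_inv_mul_mem (hΓ : IsFundamentalSequence Γ D) {n : ℕ} (hn : 1 ≤ n) {x y : G}
    (hx : x ∈ hole Γ D n) (hxy : x⁻¹ * y ∈ Γ n) : y ∈ hole Γ D n := by
  have h : y * x⁻¹ ∈ Γ n := (hΓ.mul_mem_comm hn).1 hxy
  simpa using (mul_mem_hole_iff hΓ h).2 hx

/-- Every open coset contains an element of `J n`. -/
theorem exists_mem_J_of_mem_hole (hΓ : IsFundamentalSequence Γ D) {n : ℕ} (hn : 1 ≤ n) {x : G}
    (hx : x ∈ hole Γ D n) : ∃ d ∈ J Γ D n, d⁻¹ * x ∈ Γ n := by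
  obtain ⟨d, ⟨hd, hdx⟩, -⟩ := hΓ.existsUnique_mem_coset n hn x
  refine ⟨d, (mem_J_iff hn).2 ⟨hd, mem_hole_of_inv_mul_mem hΓ hn hx ?_⟩, hdx⟩
  simpa using (Γ n).inv_mem hdx

theorem mem_hole_succ_iff {n : ℕ} {x : G} :
    x ∈ hole Γ D (n + 1) ↔ x ∈ hole Γ D n ∧ ∀ d ∈ J Γ D n, d⁻¹ * x ∉ Γ (n + 1) := by
  constructor
  · exact fun hx => ⟨hole_mono (Nat.le_succ n) hx, hx n (Nat.lt_succ_self n)⟩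
  · rintro ⟨h1, h2⟩ i hi
    rcases Nat.lt_succ_iff_lt_or_eq.1 hi with hi | rfl
    · exact h1 i hi
    · exact h2

/-- Inside `d Γ s` the next step fills only `d Γ (s + 1)`, so every other tile `v D s` of `D (s +
1)` keeps its copy of `d` open. -/
theorem mul_mem_J_succ (hΓ : IsFundamentalSequence Γ D) {s : ℕ} (hs : 1 ≤ s) {d v : G}
    (hd : d ∈ J Γ D s) (hv : v ∈ D (s + 1)) (hvs : v ∈ Γ s) (hv1 : v ≠ 1) :
    v * d ∈ J Γ D (s + 1) := by
  have hdD := (mem_J_iff hs).1 hd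
  rw [mem_J_iff (by omega), mem_hole_succ_iff]
  refine ⟨(hΓ.mem_iff s (s + 1) hs (Nat.lt_succ_self s) _).2 ⟨v, hv, hvs, d, hdD.1, rfl⟩,
    (mul_mem_hole_iff hΓ hvs).2 hdD.2, fun c hc hcv => hv1 ?_⟩
  have hcd : c = d := J_coset_fibre hΓ hs hc hd
    ((hΓ.inv_mul_mul_mem_iff hs hvs).1 (hΓ.decreasing s hs hcv))
  subst hcd
  rw [hΓ.mul_mem_comm (by omega), mul_assoc, mul_inv_cancel, mul_one] at hcv
  exact (hΓ.eq_of_mem (by omega) (hΓ.one_mem _ (by omega)) hv (by simpa using hcv)).symm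

end Fundamental

/-! ### Growth of the domains and persistence of open positions. -/

section Growth

variable {Γ : ℕ → Subgroup G} {D : ℕ → Finset G}

-- If `L ≥ 1`, then `exp (2L) ≥ 1 + 2L ≥ 3`, so `exp (-2L) ≤ 1/3`, against the bound. This makes
-- each summand less than `1`, which forces the cardinalities of the `D n` to increase strictly.
omit [Group G] in
theorem IsRapidlyGrowing.total_lt_one (hD : IsRapidlyGrowing D) :
    1 / ((D 1).card : ℝ) + ∑' j : ℕ, ((D (j + 1)).card : ℝ) / ((D (j + 2)).card : ℝ) < 1 := by
  by_contra! hL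
  have hb := hD.bound
  set L := 1 / ((D 1).card : ℝ) + ∑' j : ℕ, ((D (j + 1)).card : ℝ) / ((D (j + 2)).card : ℝ)
  have h1 : 3 ≤ Real.exp (2 * L) := by linarith [Real.add_one_le_exp (2 * L)]
  have h2 : Real.exp (-2 * L) * Real.exp (2 * L) = 1 := by
    rw [← Real.exp_add]
    simp
  nlinarith

theorem one_lt_card (hΓ : IsFundamentalSequence Γ D) (hD : IsRapidlyGrowing D) :
    1 < (D 1).card := by
  have hpos : (0 : ℝ) < (D 1).card := by
    exact_mod_cast Finset.card_pos.2 ⟨1, hΓ.one_mem 1 le_rfl⟩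
  have h0 : 0 ≤ ∑' j : ℕ, ((D (j + 1)).card : ℝ) / ((D (j + 2)).card : ℝ) :=
    tsum_nonneg fun j => by positivity
  have h1 : 1 / ((D 1).card : ℝ) < 1 := by linarith [hD.total_lt_one]
  rw [div_lt_one hpos] at h1
  exact_mod_cast h1

theorem card_lt_card_succ (hΓ : IsFundamentalSequence Γ D) (hD : IsRapidlyGrowing D) {n : ℕ}
    (hn : 1 ≤ n) : (D n).card < (D (n + 1)).card := by
  obtain ⟨n, rfl⟩ : ∃ n', n = n' + 1 := ⟨n - 1, by omega⟩
  have hpos : (0 : ℝ) < (D (n + 2)).card := by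
    exact_mod_cast Finset.card_pos.2 ⟨1, hΓ.one_mem (n + 2) (by omega)⟩
  have h0 : (0 : ℝ) ≤ 1 / ((D 1).card : ℝ) := by positivity
  have h1 := hD.summable.le_tsum n fun j _ => by positivity
  have h2 : ((D (n + 1)).card : ℝ) / ((D (n + 2)).card : ℝ) < 1 := by
    linarith [hD.total_lt_one]
  rw [div_lt_one hpos] at h2
  exact_mod_cast h2

theorem le_card (hΓ : IsFundamentalSequence Γ D) (hD : IsRapidlyGrowing D) {n : ℕ}
    (hn : 1 ≤ n) : n ≤ (D n).card := by
  induction n, hn using Nat.le_induction with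
  | base => exact (one_lt_card hΓ hD).le
  | succ n hn ih => exact ih.trans_lt (card_lt_card_succ hΓ hD hn)

/-- Supplies the second tile that `mul_mem_J_succ` needs. -/
theorem exists_ne_one (hΓ : IsFundamentalSequence Γ D) (hD : IsRapidlyGrowing D) {n : ℕ}
    (hn : 1 ≤ n) : ∃ v ∈ D (n + 1), v ∈ Γ n ∧ v ≠ 1 := by
  obtain ⟨x, hx, hxn⟩ := Finset.exists_mem_notMem_of_card_lt_card (card_lt_card_succ hΓ hD hn)
  obtain ⟨v, hv, hvn, d, hd, rfl⟩ := (hΓ.mem_iff n (n + 1) hn (Nat.lt_succ_self n) x).1 hx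
  refine ⟨v, hv, hvn, ?_⟩
  rintro rfl
  exact hxn (by simpa using hd)

/-- Every open coset of a step contains open positions of all later steps. -/
theorem exists_mem_J_le (hΓ : IsFundamentalSequence Γ D) (hD : IsRapidlyGrowing D) {n s : ℕ}
    (hn : 1 ≤ n) (hs : n ≤ s) {x : G} (hx : x ∈ hole Γ D n) :
    ∃ d ∈ J Γ D s, d⁻¹ * x ∈ Γ n := by
  induction s, hs using Nat.le_induction with
  | base => exact exists_mem_J_of_mem_hole hΓ hn hx
  | succ s hs ih =>
    obtain ⟨d, hd, hdx⟩ := ih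
    obtain ⟨v, hv, hvs, hv1⟩ := exists_ne_one hΓ hD (hn.trans hs)
    refine ⟨v * d, mul_mem_J_succ hΓ (hn.trans hs) hd hv hvs hv1, ?_⟩
    have := (hΓ.inv_mul_mul_mem_iff hn
      ((Γ n).inv_mem (hΓ.le_of_le hn hs hvs)) (a := d) (b := x)).2 hdx
    simpa [mul_assoc] using this

theorem J_nonempty (hΓ : IsFundamentalSequence Γ D) (hD : IsRapidlyGrowing D) (n : ℕ) :
    (J Γ D n).Nonempty := by
  rcases n with _ | n
  · exact ⟨1, by simp [J]⟩
  · obtain ⟨x, hx, hx1⟩ := Finset.exists_mem_ne (one_lt_card hΓ hD) 1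
    have h1 : x ∈ hole Γ D 1 := by
      intro i hi d hd
      obtain rfl : i = 0 := by omega
      rw [J, Set.mem_singleton_iff] at hd
      subst hd
      intro h
      exact hx1 (hΓ.eq_of_mem le_rfl (hΓ.one_mem 1 le_rfl) hx h).symm
    obtain ⟨d, hd, -⟩ := exists_mem_J_le hΓ hD le_rfl (by omega : 1 ≤ n + 1) h1
    exact ⟨d, hd⟩

/-- Only translations by elements of `Γ n` map the open positions of step `n` to open positions. -/
theorem mem_of_mul_hole_subset (hΓ : IsFundamentalSequence Γ D) (hD : IsRapidlyGrowing D) {n : ℕ}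
    (hn : 1 ≤ n) {u : G} (hu : ∀ x ∈ hole Γ D n, u * x ∈ hole Γ D n) : u ∈ Γ n := by
  induction n, hn using Nat.le_induction with
  | base =>
    -- The complement of `hole Γ D 1` is `Γ 1`; for `u` outside `Γ 1`, the open position `u⁻¹` would
    -- be sent to `1`, which is filled.
    by_contra h
    have h1 : u⁻¹ ∈ hole Γ D 1 := by
      intro i hi d hd
      obtain rfl : i = 0 := by omega
      rw [J, Set.mem_singleton_iff] at hd
      subst hd
      simpa using h
    have h2 := hu _ h1 0 (by omega) 1 (by simp [J])
    exact h2 (by simp [(Γ 1).one_mem])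
  | succ n hn ih =>
    have hun : u ∈ Γ n := by
      -- Each coset of `Γ n` in `hole Γ D n` still has a position open at level `n + 1`, so `u` also
      -- preserves the larger hole.
      refine ih fun x hx => ?_
      obtain ⟨d, hd, hdx⟩ := exists_mem_J_le hΓ hD hn (Nat.le_succ n) hx
      have h1 := hole_mono (Nat.le_succ n) (hu d ((mem_J_iff (by omega)).1 hd).2)
      exact mem_hole_of_inv_mul_mem hΓ hn h1 (by simpa [mul_assoc] using hdx)
    obtain ⟨d, hd⟩ := J_nonempty hΓ hD n
    have hdn := (mem_J_iff hn).1 hd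
    by_contra hcon
    -- Step `n + 1` fills `d`, hence must also fill `u⁻¹ * d`; within `d Γ n` it fills only `d Γ (n
    -- + 1)`.
    have h1 : u⁻¹ * d ∉ hole Γ D (n + 1) := fun h => hu _ h n (Nat.lt_succ_self n) d hd
      (by simp [(Γ (n + 1)).one_mem])
    rw [mem_hole_succ_iff, mul_mem_hole_iff hΓ ((Γ n).inv_mem hun)] at h1
    push Not at h1
    obtain ⟨c, hc, hcd⟩ := h1 hdn.2
    have hcd' : c = d := J_coset_fibre hΓ hn hc hd
      ((hΓ.inv_mul_mul_mem_iff hn ((Γ n).inv_mem hun)).1 (hΓ.decreasing n hn hcd))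
    subst hcd'
    rw [hΓ.mul_mem_comm (by omega), mul_assoc, mul_inv_cancel, mul_one] at hcd
    exact hcon (by simpa using (Γ (n + 1)).inv_mem hcd)

end Growth

/-! ### Periods of the array and sparsity of its open ones. -/

section Array

variable {Γ : ℕ → Subgroup G} {D : ℕ → Finset G} {enum h : ℕ → ℕ → G}

theorem mSum_succ (k : ℕ) : mSum Γ D (k + 1) = mSum Γ D k + m Γ D (k + 1) + 1 := by
  simp only [mSum, Finset.sum_range_succ _ (k + 1)]
  omega

theorem mSum_strictMono : StrictMono (mSum Γ D) :=
  strictMono_nat_of_lt_succ fun k => by rw [mSum_succ]; omega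

theorem lt_mSum (k : ℕ) : k < mSum Γ D k := by
  simp only [mSum]
  omega

/-- No step with number `m_k` writes the symbol `1`. -/
theorem not_isMarked_mSum_sub_one {k : ℕ} (hk : 1 ≤ k) (d : G) :
    ¬ IsMarked Γ D h (mSum Γ D k - 1) d := by
  have h0 := lt_mSum (Γ := Γ) (D := D) k
  rintro (hs | ⟨l, s', hl, hs', hs, -⟩)
  · omega
  · obtain ⟨l, rfl⟩ : ∃ l', l = l' + 1 := ⟨l - 1, by omega⟩
    have h1 := mSum_succ (Γ := Γ) (D := D) l
    rw [Nat.add_sub_cancel] at hs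
    -- The marked indices of block `l + 1` run from `m_l` to `m_{l+1} - 2`, so `m_k` would lie
    -- strictly between two consecutive values of the strictly increasing `mSum`.
    have h2 : k < l + 1 := mSum_strictMono.lt_iff_lt.1 (by omega : mSum Γ D k < mSum Γ D (l + 1))
    have h3 : mSum Γ D k ≤ mSum Γ D l := mSum_strictMono.monotone (by omega)
    omega

/-- Every step after the first writes the symbol `1` on at most one coset. -/
theorem IsMarked.unique {s : ℕ} (hs : 1 ≤ s) {d e : G} (hd : IsMarked Γ D h s d)
    (he : IsMarked Γ D h s e) : d = e := by
  rcases hd with hd | ⟨k, a, hk, ha, hsk, rfl⟩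
  · omega
  rcases he with he | ⟨l, b, hl, hb, hsl, rfl⟩
  · omega
  have key : ∀ {k l a b : ℕ}, 1 ≤ k → 1 ≤ l → a < m Γ D k → s = mSum Γ D (k - 1) + a →
      s = mSum Γ D (l - 1) + b → l ≤ k := by
    intro k l a b hk hl ha h1 h2
    obtain ⟨k, rfl⟩ : ∃ k', k = k' + 1 := ⟨k - 1, by omega⟩
    have h3 := mSum_succ (Γ := Γ) (D := D) k
    rw [Nat.add_sub_cancel] at h1
    have h4 : l - 1 < k + 1 :=
      mSum_strictMono.lt_iff_lt.1 (by omega : mSum Γ D (l - 1) < mSum Γ D (k + 1))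
    omega
  obtain rfl : k = l := le_antisymm (key hl hk hb hsl hsk) (key hk hl ha hsk hsl)
  obtain rfl : a = b := by omega
  rfl

theorem array_eq_one_iff (hΓ : IsFundamentalSequence Γ D) {s : ℕ} {d x : G} (hd : d ∈ J Γ D s)
    (hx : d⁻¹ * x ∈ Γ (s + 1)) : array Γ D h x = 1 ↔ IsMarked Γ D h s d := by
  have := array_apply hΓ h hd hx
  rw [mul_inv_cancel_left] at this
  rw [this]
  split_ifs with hm <;> simp [hm]

theorem array_congr (hΓ : IsFundamentalSequence Γ D) {s : ℕ} {d x y : G} (hd : d ∈ J Γ D s)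
    (hx : d⁻¹ * x ∈ Γ (s + 1)) (hy : d⁻¹ * y ∈ Γ (s + 1)) : array Γ D h x = array Γ D h y := by
  have h1 := array_apply hΓ h hd hx
  have h2 := array_apply hΓ h hd hy
  rw [mul_inv_cancel_left] at h1 h2
  rw [h1, h2]

theorem mem_per_array (hΓ : IsFundamentalSequence Γ D) {s n : ℕ} {d x : G} (hd : d ∈ J Γ D s)
    (hx : d⁻¹ * x ∈ Γ (s + 1)) (hn : s + 1 ≤ n) :
    x ∈ per (array Γ D h) (Γ n) (array Γ D h x) := fun γ hγ =>
  array_congr hΓ hd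
    ((hΓ.inv_mul_mul_mem_iff (by omega) (hΓ.le_of_le (by omega) hn hγ)).2 hx) hx

theorem mem_per_array_of_notMem_hole (hΓ : IsFundamentalSequence Γ D) {n : ℕ} {x : G}
    (hx : x ∉ hole Γ D n) : x ∈ per (array Γ D h) (Γ n) (array Γ D h x) := by
  simp only [hole, Set.mem_ofPred_eq] at hx
  push Not at hx
  obtain ⟨i, hi, d, hd, hdx⟩ := hx
  exact mem_per_array hΓ hd hdx (by omega)

theorem exists_mem_per_array (hΓ : IsFundamentalSequence Γ D) (x : G) :
    ∃ n, 1 ≤ n ∧ x ∈ per (array Γ D h) (Γ n) (array Γ D h x) := by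
  obtain ⟨s, d, hd, hdx⟩ := exists_mem_J_coset hΓ x
  exact ⟨s + 1, by omega, mem_per_array hΓ hd hdx le_rfl⟩

/-- Both symbols occur in every coset of open positions. -/
theorem notMem_per_array_of_mem_hole (hΓ : IsFundamentalSequence Γ D) (hD : IsRapidlyGrowing D)
    (hh : IsChoice Γ D enum h) {n : ℕ} (hn : 1 ≤ n) {x : G} (hx : x ∈ hole Γ D n) (α : Fin 2) :
    x ∉ per (array Γ D h) (Γ n) α := by
  have coset : ∀ {y : G}, y⁻¹ * x ∈ Γ n → x ∈ per (array Γ D h) (Γ n) α → array Γ D h y = α := by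
    intro y hy hper
    have h1 : y * x⁻¹ ∈ Γ n := by
      have := (Γ n).inv_mem hy
      rw [hΓ.mul_mem_comm hn]
      simpa using this
    simpa using hper _ h1
  intro hper
  -- Block `n` of the construction marks a point `h n (a + 1)` in every open coset of `Γ n`.
  have hone : α = 1 := by
    obtain ⟨d, hd, hdx⟩ := exists_mem_J_of_mem_hole hΓ hn hx
    obtain ⟨a, ha, rfl⟩ := (hh.enum_bijOn n hn).surjOn hd
    obtain ⟨a, rfl⟩ : ∃ a', a = a' + 1 := ⟨a - 1, by have := ha.1; omega⟩
    have ha' : a < m Γ D n := by have := ha.2; omega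
    have hJ := hh.mem_J n a hn ha'
    have hhx : (h n (a + 1))⁻¹ * x ∈ Γ n := by
      have := (Γ n).mul_mem ((Γ n).inv_mem (hh.mem_coset n a hn ha')) hdx
      simpa [mul_assoc] using this
    rw [← coset hhx hper, array_eq_one_iff hΓ hJ (by simp)]
    exact Or.inr ⟨n, a, hn, ha', rfl, rfl⟩
  subst hone
  have h0 := lt_mSum (Γ := Γ) (D := D) n
  -- Step `m_n` writes only zeros, and the coset of `x` contains a position filled by it.
  obtain ⟨d, hd, hdx⟩ := exists_mem_J_le hΓ hD hn (by omega : n ≤ mSum Γ D n - 1) hx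
  refine not_isMarked_mSum_sub_one (Γ := Γ) (D := D) (h := h) hn d ?_
  rw [← array_eq_one_iff hΓ hd (x := d) (by simp)]
  exact coset hdx hper

theorem mem_hole_iff_forall_notMem_per (hΓ : IsFundamentalSequence Γ D) (hD : IsRapidlyGrowing D)
    (hh : IsChoice Γ D enum h) {n : ℕ} (hn : 1 ≤ n) {x : G} :
    x ∈ hole Γ D n ↔ ∀ α, x ∉ per (array Γ D h) (Γ n) α :=
  ⟨notMem_per_array_of_mem_hole hΓ hD hh hn, fun hx => by
    by_contra hcon
    exact hx _ (mem_per_array_of_notMem_hole hΓ hcon)⟩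

/-- The nonperiodic positions are exactly the open ones, and `u⁻¹` maps them to each other, so
`mem_of_mul_hole_subset` applies to `u⁻¹`. -/
theorem mem_of_per_subset (hΓ : IsFundamentalSequence Γ D) (hD : IsRapidlyGrowing D)
    (hh : IsChoice Γ D enum h) {n : ℕ} (hn : 1 ≤ n) {u : G}
    (hu : ∀ α, ∀ x ∈ per (array Γ D h) (Γ n) α, u * x ∈ per (array Γ D h) (Γ n) α) : u ∈ Γ n := by
  rw [← (Γ n).inv_mem_iff]
  refine mem_of_mul_hole_subset hΓ hD hn fun x hx => ?_
  rw [mem_hole_iff_forall_notMem_per hΓ hD hh hn] at hx ⊢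
  intro α hα
  exact hx α (by simpa using hu α _ hα)

/-- Every translate of `D n` by an element of `Γ n` has at most one open position with
symbol `1`. -/
theorem eq_of_array_eq_one (hΓ : IsFundamentalSequence Γ D) {n : ℕ} (hn : 1 ≤ n) {γ i j : G}
    (hγ : γ ∈ Γ n) (hi : i ∈ J Γ D n) (hj : j ∈ J Γ D n)
    (hi1 : array Γ D h (γ * i) = 1) (hj1 : array Γ D h (γ * j) = 1) : i = j := by
  obtain ⟨s, d, hd, hds⟩ := exists_mem_J_coset hΓ (γ * i)
  obtain ⟨t, e, he, het⟩ := exists_mem_J_coset hΓ (γ * j)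
  wlog hst : s ≤ t generalizing i j s t d e
  · exact (this hj hi hj1 hi1 t e he het s d hd hds (le_of_not_ge hst)).symm
  have hiD := (mem_J_iff hn).1 hi
  have hjD := (mem_J_iff hn).1 hj
  have hns : n ≤ s := by
    by_contra hcon
    exact (mul_mem_hole_iff hΓ hγ).2 hiD.2 s (by omega) d hd hds
  have hs : 1 ≤ s := hn.trans hns
  -- Translating by `u⁻¹` moves `γ * i` to its representative `d` in `D s` without changing cosets
  -- of `Γ (s + 1)`.
  obtain ⟨u, hu⟩ : ∃ u, u = γ * i * d⁻¹ := ⟨_, rfl⟩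
  have hus : u ∈ Γ (s + 1) := by rw [hu]; exact (hΓ.mul_mem_comm (by omega)).1 hds
  have hdD := (mem_J_iff hs).1 hd
  -- `D s` is a union of tiles `v D n`; since it contains the copy `d` of `i`, it contains the whole
  -- tile, with the copy of `j`.
  have hw : u⁻¹ * (γ * j) ∈ D s := by
    rcases hns.eq_or_lt with rfl | hns
    · have : d = i := J_coset_fibre hΓ hn hd hi
        ((hΓ.inv_mul_mul_mem_iff hn hγ).1 (hΓ.decreasing n hn hds))
      subst this
      simpa [hu] using hjD.1
    · obtain ⟨v, hv, hvn, c, hc, hdv⟩ := (hΓ.mem_iff n s hn hns d).1 hdD.1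
      have hun : u ∈ Γ n := hΓ.le_of_le hn (by omega) hus
      have hγi : γ * i = u * (v * c) := by rw [← hdv, hu]; simp
      have hci : c = i := by
        refine hΓ.eq_of_mem hn hc hiD.1 ?_
        rw [← hΓ.inv_mul_mul_mem_iff hn hγ, hγi, hΓ.inv_mul_mul_mem_iff hn hun,
          hΓ.inv_mul_mul_mem_iff hn hvn]
        simp
      subst hci
      have hγ' : γ = u * v := by simpa [← mul_assoc] using hγi
      have : u⁻¹ * (γ * j) = v * j := by rw [hγ']; group
      rw [this]
      exact (hΓ.mem_iff n s hn hns _).2 ⟨v, hv, hvn, j, hjD.1, rfl⟩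
  -- As `s ≤ t`, the position `γ * j` is still open before step `s + 1`; hence that step fills it
  -- too, and its unique marked element identifies `i` with `j`.
  have hwJ : u⁻¹ * (γ * j) ∈ J Γ D s := by
    refine (mem_J_iff hs).2 ⟨hw, fun r hr c hc hcr => ?_⟩
    rw [hΓ.inv_mul_mul_mem_iff (by omega) (hΓ.le_of_le (by omega) (by omega)
      ((Γ (s + 1)).inv_mem hus))] at hcr
    have := (J_coset_unique hΓ hc he hcr het).1
    omega
  have hwm : (u⁻¹ * (γ * j))⁻¹ * (γ * j) ∈ Γ (s + 1) := by
    have : (u⁻¹ * (γ * j))⁻¹ * (γ * j) = (γ * j)⁻¹ * (u * (γ * j)) := by group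
    rw [this, hΓ.inv_mul_mul_mem_iff (by omega) hus, inv_mul_cancel]
    exact (Γ (s + 1)).one_mem
  have h1 := ((array_eq_one_iff hΓ hd hds).1 hi1).unique hs
    ((array_eq_one_iff hΓ hwJ hwm).1 hj1)
  rw [hu] at h1
  have h2 : d = d * i⁻¹ * j := by simpa [mul_assoc] using h1
  have h3 : i⁻¹ * j = 1 := by
    rw [mul_assoc] at h2
    exact left_eq_mul.1 h2
  exact inv_mul_eq_one.1 h3

end Array

end Toeplitz

namespace Toeplitz

variable {G : Type*} [Group G]

/-! ### The canonical map to the odometer. -/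

section Canonical

variable {η : G → Fin 2} {Γ : ℕ → Subgroup G}

/-- A decreasing sequence of normal subgroups of finite index such that every position is periodic
for one of them, and each of them is the full group of periods of its periodic part. -/
structure IsPeriodStructure (η : G → Fin 2) (Γ : ℕ → Subgroup G) : Prop where
  normal : ∀ n, (Γ n).Normal
  finiteIndex : ∀ n, (Γ n).FiniteIndex
  antitone : Antitone Γ
  exists_mem_per : ∀ x, ∃ n, x ∈ per η (Γ n) (η x)
  essential : ∀ n u, (∀ α, ∀ x ∈ per η (Γ n) α, u * x ∈ per η (Γ n) α) → u ∈ Γ n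

theorem mul_mem_per {x : G → Fin 2} {H : Subgroup G} {α : Fin 2} {γ p : G} (hγ : γ ∈ H)
    (hp : p ∈ per x H α) : γ * p ∈ per x H α := fun δ hδ => by
  rw [← mul_assoc]
  exact hp _ (H.mul_mem hδ hγ)

theorem mem_per_shift {x : G → Fin 2} {H : Subgroup G} (hH : H.Normal) {α : Fin 2} {g p : G} :
    p ∈ per (shift g x) H α ↔ g⁻¹ * p ∈ per x H α := by
  constructor
  · intro hp γ hγ
    have := hp _ (hH.conj_mem γ hγ g)
    simpa [shift, mul_assoc] using this
  · intro hp γ hγ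
    have := hp _ (hH.conj_mem γ hγ g⁻¹)
    simpa [shift, mul_assoc] using this

/-- The closure of the set of the translates of `η` by the elements of the coset `gH`. -/
def cosetClosure (η : G → Fin 2) (H : Subgroup G) (g : G) : Set (G → Fin 2) :=
  closure ((fun a => shift a η) '' {a | g⁻¹ * a ∈ H})

theorem isClosed_cosetClosure (H : Subgroup G) (g : G) : IsClosed (cosetClosure η H g) :=
  isClosed_closure

theorem cosetClosure_congr {H : Subgroup G} {g g' : G} (hg : g⁻¹ * g' ∈ H) :
    cosetClosure η H g = cosetClosure η H g' := by
  have : {a | g⁻¹ * a ∈ H} = {a | g'⁻¹ * a ∈ H} := by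
    ext a
    have h1 : g⁻¹ * a = g⁻¹ * g' * (g'⁻¹ * a) := by group
    change g⁻¹ * a ∈ H ↔ g'⁻¹ * a ∈ H
    rw [h1, H.mul_mem_cancel_left hg]
  rw [cosetClosure, cosetClosure, this]

theorem cosetClosure_mono {H K : Subgroup G} (hHK : H ≤ K) (g : G) :
    cosetClosure η H g ⊆ cosetClosure η K g :=
  closure_mono (Set.image_mono fun _ ha => hHK ha)

theorem shift_mem_cosetClosure (H : Subgroup G) (a : G) : shift a η ∈ cosetClosure η H a :=
  subset_closure ⟨a, by simp [H.one_mem], rfl⟩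

theorem shift_mem_cosetClosure_mul {H : Subgroup G} {x : G → Fin 2} {g : G}
    (hx : x ∈ cosetClosure η H g) (a : G) : shift a x ∈ cosetClosure η H (a * g) :=
  map_mem_closure (continuous_shift a) hx (by
    rintro _ ⟨b, hb, rfl⟩
    exact ⟨a * b, by simpa [mul_assoc] using hb, shift_shift a b η⟩)

/-- There are finitely many cosets, and closure commutes with finite unions. -/
theorem exists_mem_cosetClosure {H : Subgroup G} (hH : H.FiniteIndex) {T : Set G} {x : G → Fin 2}
    (hx : x ∈ closure ((fun a => shift a η) '' T)) : ∃ a ∈ T, x ∈ cosetClosure η H a := by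
  have hT : (fun a => shift a η) '' T =
      ⋃ c : G ⧸ H, (fun a => shift a η) '' {a | a ∈ T ∧ (a : G ⧸ H) = c} := by
    rw [← Set.image_iUnion]
    congr 1
    ext a
    simp
  rw [hT, closure_iUnion_of_finite, Set.mem_iUnion] at hx
  obtain ⟨c, hc⟩ := hx
  obtain ⟨_, ⟨a, ⟨haT, rfl⟩, -⟩⟩ := closure_nonempty_iff.1 ⟨x, hc⟩
  refine ⟨a, haT, closure_mono (Set.image_mono ?_) hc⟩
  exact fun b hb => QuotientGroup.eq.1 hb.2.symm

theorem exists_mem_cosetClosure_of_mem_orbitClosure {H : Subgroup G} (hH : H.FiniteIndex)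
    {x : G → Fin 2} (hx : x ∈ orbitClosure η) : ∃ a, x ∈ cosetClosure η H a := by
  rw [orbitClosure, ← Set.image_univ] at hx
  obtain ⟨a, -, ha⟩ := exists_mem_cosetClosure hH hx
  exact ⟨a, ha⟩

theorem apply_eq_of_mem_cosetClosure {H : Subgroup G} {x : G → Fin 2} {g p : G} {α : Fin 2}
    (hx : x ∈ cosetClosure η H g) (hp : p ∈ per η H α) : x (g * p) = α := by
  have hcl : IsClosed {y : G → Fin 2 | y (g * p) = α} :=
    isClosed_eq (continuous_apply _) continuous_const
  refine closure_minimal ?_ hcl hx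
  rintro _ ⟨a, ha, rfl⟩
  have := hp (a⁻¹ * g) (by simpa using H.inv_mem ha)
  simpa [shift, mul_assoc] using this

/-- A limit of translates of `η` by elements of `g Γ n` has the translated periodic part. -/
theorem IsPeriodStructure.mem_per_iff (hη : IsPeriodStructure η Γ) {n : ℕ} {x : G → Fin 2} {g : G}
    (hx : x ∈ cosetClosure η (Γ n) g) (α : Fin 2) (p : G) :
    p ∈ per x (Γ n) α ↔ g⁻¹ * p ∈ per η (Γ n) α := by
  constructor
  · intro hp γ hγ
    -- The value of `η` at this position is periodic at some level `N`, so it can be read off from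
    -- `x` once `x` is located in a coset `b Γ N` with `b ∈ g Γ n`.
    obtain ⟨N, hN⟩ := hη.exists_mem_per (γ * (g⁻¹ * p))
    obtain ⟨b, hb, hxb⟩ := exists_mem_cosetClosure (hη.finiteIndex N) hx
    rw [← apply_eq_of_mem_cosetClosure hxb hN, ← hp (b * γ * g⁻¹)]
    · simp [mul_assoc]
    · have : b * γ * g⁻¹ = g * (g⁻¹ * b * γ) * g⁻¹ := by group
      rw [this]
      exact (hη.normal n).conj_mem _ ((Γ n).mul_mem hb hγ) g
  · intro hp γ hγ
    have h1 : g⁻¹ * γ * g ∈ Γ n := by simpa using (hη.normal n).conj_mem γ hγ g⁻¹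
    have := apply_eq_of_mem_cosetClosure hx (mul_mem_per h1 hp)
    simpa [mul_assoc] using this

/-- Some coset closure contains `x`; comparing periodic parts and using `essential` shows that it
belongs to the coset of `g`. This translates the definition of `π` through `C_n` into closed sets.
-/
theorem IsPeriodStructure.mem_cosetClosure_iff (hη : IsPeriodStructure η Γ) {n : ℕ}
    {x : G → Fin 2} (hx : x ∈ orbitClosure η) (g : G) :
    x ∈ cosetClosure η (Γ n) g ↔ ∀ α p, p ∈ per x (Γ n) α ↔ g⁻¹ * p ∈ per η (Γ n) α := by
  refine ⟨fun h => hη.mem_per_iff h, fun h => ?_⟩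
  obtain ⟨a, ha⟩ := exists_mem_cosetClosure_of_mem_orbitClosure (hη.finiteIndex n) hx
  rwa [cosetClosure_congr (g' := a)]
  refine hη.essential n _ fun α p hp => ?_
  rw [mul_assoc, ← h, hη.mem_per_iff ha]
  simpa using hp

theorem IsPeriodStructure.mem_of_mem_cosetClosure (hη : IsPeriodStructure η Γ) {n : ℕ}
    {x : G → Fin 2} {g g' : G} (hg : x ∈ cosetClosure η (Γ n) g)
    (hg' : x ∈ cosetClosure η (Γ n) g') : g⁻¹ * g' ∈ Γ n := by
  refine hη.essential n _ fun α p hp => ?_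
  rw [mul_assoc, ← hη.mem_per_iff hg, hη.mem_per_iff hg']
  simpa using hp

theorem coe_smul_orbitClosure (g : G) (x : orbitClosure η) : (g • x).1 = shift g x.1 := rfl

theorem IsPeriodStructure.exists_samePeriodicPart_iff (hη : IsPeriodStructure η Γ) {n : ℕ}
    (x : orbitClosure η) (g : G) :
    (∃ y ∈ samePeriodicPart η (Γ n), x = g • y) ↔ x.1 ∈ cosetClosure η (Γ n) g := by
  rw [hη.mem_cosetClosure_iff x.2]
  constructor
  · rintro ⟨y, hy, rfl⟩ α p
    rw [coe_smul_orbitClosure, mem_per_shift (hη.normal n), hy α]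
  · intro h
    refine ⟨g⁻¹ • x, fun α => ?_, by simp⟩
    ext p
    rw [coe_smul_orbitClosure, mem_per_shift (hη.normal n), h]
    simp

theorem IsPeriodStructure.isCanonicalMap_iff (hη : IsPeriodStructure η Γ)
    {π : orbitClosure η → Odometer Γ} : IsCanonicalMap η Γ π ↔
      ∀ x n (g : G), (π x).1 n = (g : G ⧸ Γ n) ↔ x.1 ∈ cosetClosure η (Γ n) g := by
  simp only [IsCanonicalMap, hη.exists_samePeriodicPart_iff]

theorem IsPeriodStructure.exists_isCanonicalMap (hη : IsPeriodStructure η Γ) :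
    ∃ π : orbitClosure η → Odometer Γ, IsCanonicalMap η Γ π := by
  choose a ha using fun (x : orbitClosure η) n =>
    exists_mem_cosetClosure_of_mem_orbitClosure (hη.finiteIndex n) x.2
  have key : ∀ x n (g : G), (a x n : G ⧸ Γ n) = (g : G ⧸ Γ n) ↔
      x.1 ∈ cosetClosure η (Γ n) g := by
    intro x n g
    rw [QuotientGroup.eq]
    refine ⟨fun h => ?_, fun h => hη.mem_of_mem_cosetClosure (ha x n) h⟩
    rw [← cosetClosure_congr h]
    exact ha x n
  refine ⟨fun x => ⟨fun n => (a x n : G ⧸ Γ n), fun n g hg => ?_⟩, hη.isCanonicalMap_iff.2 key⟩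
  rw [key] at hg ⊢
  exact cosetClosure_mono (hη.antitone (Nat.le_succ n)) g hg

end Canonical

/-! # Topology and invariant measures of odometers -/

section Odometer

variable {Γ : ℕ → Subgroup G}

namespace Odometer

/-- The set of the points with `n`-th coordinate `c`. -/
def cylinder (n : ℕ) (c : G ⧸ Γ n) : Set (Odometer Γ) := {x | x.1 n = c}

theorem coe_smul (g : G) (x : Odometer Γ) (n : ℕ) : (g • x).1 n = g • x.1 n := rfl

theorem apply_eq_of_le {n N : ℕ} (hn : n ≤ N) {x : Odometer Γ} {g : G}
    (hx : x.1 N = (g : G ⧸ Γ N)) : x.1 n = (g : G ⧸ Γ n) := by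
  induction N, hn using Nat.le_induction with
  | base => exact hx
  | succ N _ ih => exact ih (x.2 N g hx)

theorem apply_eq_apply_of_le {n N : ℕ} (hn : n ≤ N) {x y : Odometer Γ} (h : x.1 N = y.1 N) :
    x.1 n = y.1 n := by
  obtain ⟨g, hg⟩ := QuotientGroup.mk_surjective (x.1 N)
  rw [apply_eq_of_le hn hg.symm, apply_eq_of_le hn (hg.trans h).symm]

theorem continuous_iff_isOpen_cylinder {X : Type*} [TopologicalSpace X] {f : X → Odometer Γ} :
    Continuous f ↔ ∀ n c, IsOpen (f ⁻¹' cylinder n c) := by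
  let : ∀ n, TopologicalSpace (G ⧸ Γ n) := fun _ => ⊥
  have : ∀ n, DiscreteTopology (G ⧸ Γ n) := fun _ => ⟨rfl⟩
  rw [continuous_induced_rng, continuous_pi_iff]
  exact forall_congr' fun n => continuous_discrete_rng

theorem isOpen_cylinder (n : ℕ) (c : G ⧸ Γ n) : IsOpen (cylinder n c) :=
  continuous_iff_isOpen_cylinder.1 continuous_id n c

theorem isTopologicalBasis_cylinder : TopologicalSpace.IsTopologicalBasis
    (Set.range fun p : (n : ℕ) × (G ⧸ Γ n) => cylinder p.1 p.2) := by
  refine TopologicalSpace.isTopologicalBasis_of_isOpen_of_nhds ?_ ?_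
  · rintro _ ⟨p, rfl⟩
    exact isOpen_cylinder _ _
  · intro x U hx hU
    let : ∀ n, TopologicalSpace (G ⧸ Γ n) := fun _ => ⊥
    obtain ⟨V, hV, rfl⟩ := isOpen_induced_iff.1 hU
    obtain ⟨I, u, hu, hIV⟩ := isOpen_pi_iff.1 hV _ hx
    -- A coordinate determines all earlier ones, so the largest index in `I` suffices.
    refine ⟨_, ⟨⟨I.sup id, x.1 (I.sup id)⟩, rfl⟩, rfl, fun y hy => hIV fun i hi => ?_⟩
    have : y.1 i = x.1 i := apply_eq_apply_of_le (Finset.le_sup (f := id) hi) hy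
    rw [this]
    exact (hu i hi).2

instance : T2Space (Odometer Γ) := by
  let : ∀ n, TopologicalSpace (G ⧸ Γ n) := fun _ => ⊥
  have : ∀ n, DiscreteTopology (G ⧸ Γ n) := fun _ => ⟨rfl⟩
  exact T2Space.of_injective_continuous Subtype.val_injective continuous_induced_dom

theorem secondCountableTopology [Countable G] : SecondCountableTopology (Odometer Γ) :=
  have : ∀ n, Countable (G ⧸ Γ n) := fun _ => Quotient.countable
  isTopologicalBasis_cylinder.secondCountableTopology (Set.countable_range _)

theorem isPiSystem_cylinder :
    IsPiSystem (Set.range fun p : (n : ℕ) × (G ⧸ Γ n) => cylinder p.1 p.2) := by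
  have key : ∀ {m n : ℕ} (c : G ⧸ Γ m) (d : G ⧸ Γ n), m ≤ n →
      (cylinder m c ∩ cylinder n d).Nonempty → cylinder m c ∩ cylinder n d = cylinder n d := by
    rintro m n c d hmn ⟨x, hxc, hxd⟩
    refine Set.inter_eq_right.2 fun y hy => ?_
    exact (apply_eq_apply_of_le hmn (Eq.trans hy (Eq.symm hxd))).trans hxc
  rintro _ ⟨⟨m, c⟩, rfl⟩ _ ⟨⟨n, d⟩, rfl⟩ hne
  rcases le_total m n with h | h
  · exact ⟨⟨n, d⟩, (key c d h hne).symm⟩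
  · rw [Set.inter_comm] at hne
    exact ⟨⟨m, c⟩, ((Set.inter_comm _ _).trans (key d c h hne)).symm⟩

theorem image_smul_cylinder (g : G) (n : ℕ) (c : G ⧸ Γ n) :
    (fun x => g • x) '' cylinder n c = cylinder n (g • c) := by
  ext x
  constructor
  · rintro ⟨y, hy, rfl⟩
    exact congrArg (g • ·) hy
  · intro hx
    refine ⟨g⁻¹ • x, ?_, by simp⟩
    have hx' : x.1 n = g • c := hx
    change g⁻¹ • x.1 n = c
    rw [hx', inv_smul_smul]

theorem continuous_smul (g : G) : Continuous fun x : Odometer Γ => g • x := by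
  refine continuous_iff_isOpen_cylinder.2 fun n c => ?_
  have : (fun x : Odometer Γ => g • x) ⁻¹' cylinder n c = cylinder n (g⁻¹ • c) := by
    ext x
    exact eq_inv_smul_iff.symm
  rw [this]
  exact isOpen_cylinder _ _

/-- An invariant measure gives all cylinders of the same level the same mass. -/
theorem measure_cylinder {ν : Measure (Odometer Γ)} (hν : IsInvariantMeasure G ν) {n : ℕ}
    (hn : (Γ n).FiniteIndex) (c : G ⧸ Γ n) : ν (cylinder n c) = ((Γ n).index : ENNReal)⁻¹ := by
  have := hν.isProbabilityMeasure
  have hc : ∀ c : G ⧸ Γ n, ν (cylinder n c) = ν (cylinder n ((1 : G) : G ⧸ Γ n)) := by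
    intro c
    obtain ⟨g, rfl⟩ := QuotientGroup.mk_surjective c
    have h1 := hν.invariant g _ (isOpen_cylinder n ((1 : G) : G ⧸ Γ n)).measurableSet
    rwa [image_smul_cylinder, MulAction.Quotient.smul_coe, smul_eq_mul, mul_one] at h1
  rw [hc c]
  have : Fintype (G ⧸ Γ n) := Fintype.ofFinite _
  have hU : (⋃ c : G ⧸ Γ n, cylinder n c) = Set.univ :=
    Set.eq_univ_of_forall fun x => Set.mem_iUnion.2 ⟨x.1 n, rfl⟩
  have h1 : ν (⋃ c : G ⧸ Γ n, cylinder n c) = ∑ c : G ⧸ Γ n, ν (cylinder n c) := by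
    rw [measure_iUnion, tsum_fintype]
    · intro c d hcd
      exact Set.disjoint_left.2 fun x hx hx' => hcd (Eq.trans (Eq.symm hx) hx')
    · exact fun c => (isOpen_cylinder n c).measurableSet
  rw [hU, measure_univ, Finset.sum_congr rfl fun c _ => hc c, Finset.sum_const, Finset.card_univ,
    nsmul_eq_mul, ← Nat.card_eq_fintype_card, mul_comm] at h1
  exact ENNReal.eq_inv_of_mul_eq_one_left h1.symm

/-- An odometer has at most one invariant measure. -/
theorem eq_of_isInvariantMeasure [Countable G] (hΓ : ∀ n, (Γ n).FiniteIndex)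
    {ν ν' : Measure (Odometer Γ)} (hν : IsInvariantMeasure G ν) (hν' : IsInvariantMeasure G ν') :
    ν' = ν := by
  have := hν.isProbabilityMeasure
  have := hν'.isProbabilityMeasure
  have := secondCountableTopology (Γ := Γ)
  refine ext_of_generate_finite _ ?_ isPiSystem_cylinder ?_ (by simp)
  · exact isTopologicalBasis_cylinder.borel_eq_generateFrom
  · rintro _ ⟨⟨n, c⟩, rfl⟩
    simp only [measure_cylinder hν (hΓ n), measure_cylinder hν' (hΓ n)]

end Odometer

end Odometer

end Toeplitz

namespace Toeplitz

variable {G : Type*} [Group G]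

/-! ### The factor map, injectivity, and null sets of nonperiodic ones. -/

section Conjugacy

variable {η : G → Fin 2} {Γ : ℕ → Subgroup G} {π : orbitClosure η → Odometer Γ}

/-- Preimages of cylinders are closed and, at each level, finitely many of them partition the space;
hence they are open. The image is compact, and it is dense because the orbit of `η` meets every
cylinder. -/
theorem IsPeriodStructure.isFactorMap (hη : IsPeriodStructure η Γ) (hπ : IsCanonicalMap η Γ π) :
    IsFactorMap G π := by
  rw [hη.isCanonicalMap_iff] at hπ
  have hcont : Continuous π := by
    rw [Odometer.continuous_iff_isOpen_cylinder]
    intro n c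
    have : Finite (G ⧸ Γ n) := have := hη.finiteIndex n; inferInstance
    have hc : π ⁻¹' Odometer.cylinder n c = (⋃ d ∈ {d | d ≠ c}, π ⁻¹' Odometer.cylinder n d)ᶜ := by
      ext x
      simp only [Odometer.cylinder, Set.mem_preimage, Set.mem_ofPred_eq, Set.mem_compl_iff,
        Set.mem_iUnion, exists_prop, not_exists, not_and]
      exact ⟨fun hx d hd hxd => hd (hxd.symm.trans hx), fun hx => by_contra fun hc => hx _ hc rfl⟩
    rw [hc, isOpen_compl_iff]
    refine (Set.toFinite _).isClosed_biUnion fun d _ => ?_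
    obtain ⟨g, rfl⟩ := QuotientGroup.mk_surjective d
    have hg : π ⁻¹' Odometer.cylinder n (g : G ⧸ Γ n) =
        Subtype.val ⁻¹' cosetClosure η (Γ n) g := Set.ext fun x => hπ x n g
    rw [hg]
    exact (isClosed_cosetClosure _ _).preimage continuous_subtype_val
  refine ⟨hcont, ?_, fun g x => ?_⟩
  · have : CompactSpace (orbitClosure η) := isCompact_iff_compactSpace.1 isClosed_closure.isCompact
    have hclosed : IsClosed (Set.range π) := (isCompact_range hcont).isClosed
    have hdense : Dense (Set.range π) := by
      rw [Odometer.isTopologicalBasis_cylinder.dense_iff]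
      rintro _ ⟨⟨n, c⟩, rfl⟩ -
      obtain ⟨g, rfl⟩ := QuotientGroup.mk_surjective c
      exact ⟨_, (hπ ⟨shift g η, subset_closure ⟨g, rfl⟩⟩ n g).2 (shift_mem_cosetClosure _ g),
        Set.mem_range_self _⟩
    exact Set.range_eq_univ.1 (hclosed.closure_eq.symm.trans hdense.closure_eq)
  · refine Subtype.ext (funext fun n => ?_)
    obtain ⟨a, ha⟩ := QuotientGroup.mk_surjective ((π x).1 n)
    rw [Odometer.coe_smul, ← ha, MulAction.Quotient.smul_coe, smul_eq_mul, hπ]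
    exact shift_mem_cosetClosure_mul ((hπ x n a).1 ha.symm) g

theorem isInvariantSet_of_forall_smul_mem {X : Type*} [MulAction G X] {A : Set X}
    (hA : ∀ (g : G), ∀ x ∈ A, g • x ∈ A) : IsInvariantSet G A := by
  refine fun g => Set.Subset.antisymm ?_ fun x hx => ⟨g⁻¹ • x, hA _ _ hx, smul_inv_smul g x⟩
  rintro _ ⟨x, hx, rfl⟩
  exact hA g x hx

theorem IsInvariantMeasure.map {X Y : Type*} [MulAction G X] [MulAction G Y] [MeasurableSpace X]
    [MeasurableSpace Y] {μ : Measure X} (hμ : IsInvariantMeasure G μ) {f : X → Y}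
    (hf : Measurable f) (hfG : ∀ (g : G) x, f (g • x) = g • f x)
    (hY : ∀ g : G, Measurable fun y : Y => g • y) : IsInvariantMeasure G (μ.map f) := by
  have := hμ.isProbabilityMeasure
  refine ⟨Measure.isProbabilityMeasure_map hf.aemeasurable, fun g A hA => ?_⟩
  have himage : (fun y : Y => g • y) '' A = (fun y => g⁻¹ • y) ⁻¹' A := by
    ext y
    exact ⟨by rintro ⟨z, hz, rfl⟩; simpa using hz, fun hy => ⟨g⁻¹ • y, hy, by simp⟩⟩
  rw [Measure.map_apply hf hA, Measure.map_apply hf (himage ▸ hY g⁻¹ hA),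
    ← hμ.invariant g _ (hf hA)]
  congr 1
  ext x
  constructor
  · rintro ⟨y, hy, hyx⟩
    refine ⟨g⁻¹ • x, ?_, by simp⟩
    change f (g⁻¹ • x) ∈ A
    rw [hfG, ← hyx]
    simpa using hy
  · rintro ⟨z, hz, rfl⟩
    exact ⟨f z, hz, (hfG g z).symm⟩

/-- A factor map that is injective on an invariant Borel set of full measure is a measure
conjugacy onto the image measure. -/
theorem IsFactorMap.isMeasureConjugacy {X Y : Type*} [MulAction G X] [MulAction G Y]
    [TopologicalSpace X] [TopologicalSpace Y] [MeasurableSpace X] [MeasurableSpace Y]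
    [StandardBorelSpace X] [OpensMeasurableSpace X] [BorelSpace Y]
    [MeasurableSpace.CountablySeparated Y]
    {f : X → Y} (hf : IsFactorMap G f) {μ : Measure X} {A : Set X} (hA : MeasurableSet A)
    (hAG : IsInvariantSet G A) (hinj : Set.InjOn f A) (hμA : μ Aᶜ = 0) :
    IsMeasureConjugacy G f μ (μ.map f) := by
  have hfm : Measurable f := hf.continuous.measurable
  have : StandardBorelSpace A := hA.standardBorel
  -- Lusin–Souslin: an injective measurable map on a standard Borel space is an embedding.
  have hemb : MeasurableEmbedding fun x : A => f x :=
    (hfm.comp measurable_subtype_coe).measurableEmbedding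
      fun x y hxy => Subtype.ext (hinj x.2 y.2 hxy)
  have hY := hemb.measurableSet_range
  have he : ∀ x : A, (hemb.equivRange x : Y) = f x := fun x => by rw [hemb.equivRange_apply]
  refine ⟨hf, A, Set.range fun x : A => f x, hA, hAG, hμA, hY, ?_, ?_, hemb.equivRange,
    he, hemb.equivRange.measurable, ?_⟩
  · refine isInvariantSet_of_forall_smul_mem ?_
    rintro g _ ⟨x, rfl⟩
    exact ⟨⟨g • x.1, (hAG g).subset ⟨x.1, x.2, rfl⟩⟩, hf.equivariant g x⟩
  · rw [Measure.map_apply hfm hY.compl]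
    exact measure_mono_null (fun x hx => fun hxA => hx ⟨⟨x, hxA⟩, rfl⟩) hμA
  · ext B hB
    have hB' := hY.subtype_image hB
    rw [Measure.map_apply hemb.equivRange.measurable hB,
      comap_subtype_coe_apply hA, comap_subtype_coe_apply hY, Measure.map_apply hfm hB']
    have h1 : Subtype.val '' (hemb.equivRange ⁻¹' B) = A ∩ f ⁻¹' (Subtype.val '' B) := by
      ext x
      constructor
      · rintro ⟨x, hx, rfl⟩
        exact ⟨x.2, ⟨_, hx, he x⟩⟩
      · rintro ⟨hxA, b, hb, hbx⟩
        refine ⟨⟨x, hxA⟩, ?_, rfl⟩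
        have : hemb.equivRange ⟨x, hxA⟩ = b := Subtype.ext ((he _).trans hbx.symm)
        change hemb.equivRange ⟨x, hxA⟩ ∈ B
        rwa [this]
    rw [h1, Set.inter_comm, measure_inter_conull hμA]

/-- The points of the orbit closure all of whose symbols `1` are periodic. -/
def periodicOnes (η : G → Fin 2) (Γ : ℕ → Subgroup G) : Set (orbitClosure η) :=
  {x | ∀ p, x.1 p = 1 → ∃ n, p ∈ per x.1 (Γ n) 1}

theorem measurableSet_apply_eq [Countable G] (p : G) (α : Fin 2) :
    MeasurableSet {x : orbitClosure η | x.1 p = α} :=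
  (isClosed_eq ((continuous_apply p).comp continuous_subtype_val)
    continuous_const).measurableSet

theorem measurableSet_mem_per [Countable G] (H : Subgroup G) (p : G) (α : Fin 2) :
    MeasurableSet {x : orbitClosure η | p ∈ per x.1 H α} := by
  have : {x : orbitClosure η | p ∈ per x.1 H α} = ⋂ γ : H, {x | x.1 (γ * p) = α} := by
    ext x
    simp [per]
  rw [this]
  exact MeasurableSet.iInter fun γ => measurableSet_apply_eq _ α

theorem measurableSet_periodicOnes [Countable G] : MeasurableSet (periodicOnes η Γ) := by
  have : periodicOnes η Γ =
      ⋂ p, ({x | x.1 p = 1}ᶜ ∪ ⋃ n, {x : orbitClosure η | p ∈ per x.1 (Γ n) 1}) := by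
    ext x
    simp [periodicOnes, imp_iff_not_or]
  rw [this]
  exact MeasurableSet.iInter fun p => (measurableSet_apply_eq p 1).compl.union
    (MeasurableSet.iUnion fun n => measurableSet_mem_per _ p 1)

theorem IsPeriodStructure.isInvariantSet_periodicOnes (hη : IsPeriodStructure η Γ) :
    IsInvariantSet G (periodicOnes η Γ) := by
  refine isInvariantSet_of_forall_smul_mem fun g x hx p hp => ?_
  obtain ⟨n, hn⟩ := hx (g⁻¹ * p) hp
  exact ⟨n, (mem_per_shift (hη.normal n)).2 hn⟩

theorem IsPeriodStructure.per_eq_per (hη : IsPeriodStructure η Γ) (hπ : IsCanonicalMap η Γ π)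
    {x y : orbitClosure η} (hxy : π x = π y) (n : ℕ) (α : Fin 2) :
    per x.1 (Γ n) α = per y.1 (Γ n) α := by
  rw [hη.isCanonicalMap_iff] at hπ
  obtain ⟨g, hg⟩ := QuotientGroup.mk_surjective ((π x).1 n)
  ext p
  rw [hη.mem_per_iff ((hπ x n g).1 hg.symm), hη.mem_per_iff ((hπ y n g).1 (hxy ▸ hg.symm))]

theorem IsPeriodStructure.injOn_periodicOnes (hη : IsPeriodStructure η Γ)
    (hπ : IsCanonicalMap η Γ π) : Set.InjOn π (periodicOnes η Γ) := by
  have key : ∀ {x y : orbitClosure η}, x ∈ periodicOnes η Γ → π x = π y →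
      ∀ p, x.1 p = 1 → y.1 p = 1 := by
    intro x y hx hxy p hp
    obtain ⟨n, hn⟩ := hx p hp
    rw [hη.per_eq_per hπ hxy] at hn
    simpa using hn 1 (Γ n).one_mem
  intro x hx y hy hxy
  refine Subtype.ext (funext fun p => ?_)
  have h1 := key hx hxy p
  have h2 := key hy hxy.symm p
  have hfin : ∀ a b : Fin 2, (a = 1 → b = 1) → (b = 1 → a = 1) → a = b := by decide
  exact hfin _ _ h1 h2

/-- The symbols `1` of `η` in the part that is not `Γ n`-periodic are sparse: that part is the union
of the cosets of a finite set `F` such that every translate `γF`, `γ ∈ Γ n`, has at most one `1`. -/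
def HasSparseOnes (η : G → Fin 2) (Γ : ℕ → Subgroup G) : Prop :=
  ∀ n, ∃ F : Finset G, (∀ x, (∀ α, x ∉ per η (Γ n) α) → ∃ d ∈ F, d⁻¹ * x ∈ Γ n) ∧
    ∀ γ ∈ Γ n, ∀ i ∈ F, ∀ j ∈ F, η (γ * i) = 1 → η (γ * j) = 1 → i = j

/-- Having a `1` at both `i` and `j` is an open condition, so sparsity survives limits. -/
theorem eq_of_mem_cosetClosure_of_sparse {H : Subgroup G} {F : Finset G}
    (hF : ∀ γ ∈ H, ∀ i ∈ F, ∀ j ∈ F, η (γ * i) = 1 → η (γ * j) = 1 → i = j)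
    {y : G → Fin 2} (hy : y ∈ cosetClosure η H 1) {i j : G} (hi : i ∈ F) (hj : j ∈ F)
    (hyi : y i = 1) (hyj : y j = 1) : i = j := by
  by_contra hij
  have hcl : IsClosed {y : G → Fin 2 | y i = 1 ∧ y j = 1}ᶜ := by
    rw [isClosed_compl_iff]
    have hop : ∀ k : G, IsOpen {y : G → Fin 2 | y k = 1} := fun k =>
      (isOpen_discrete {(1 : Fin 2)}).preimage (continuous_apply (A := fun _ : G => Fin 2) k)
    exact (hop i).inter (hop j)
  refine closure_minimal ?_ hcl hy ⟨hyi, hyj⟩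
  rintro _ ⟨a, ha, rfl⟩ ⟨h1, h2⟩
  exact hij (hF a⁻¹ (H.inv_mem (by simpa using ha)) i hi j hj h1 h2)

/-- The points with a symbol `1` at the position `1` that is not `Γ n`-periodic have small mass. -/
theorem IsPeriodStructure.measure_le [Countable G] (hη : IsPeriodStructure η Γ)
    (hs : HasSparseOnes η Γ) {μ : Measure (orbitClosure η)} (hμ : IsInvariantMeasure G μ) (n : ℕ) :
    μ {x | x.1 1 = 1 ∧ 1 ∉ per x.1 (Γ n) 1} ≤ ((Γ n).index : ENNReal)⁻¹ := by
  obtain ⟨π, hπ⟩ := hη.exists_isCanonicalMap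
  have hfac := hη.isFactorMap hπ
  rw [hη.isCanonicalMap_iff] at hπ
  obtain ⟨F, hF, hF1⟩ := hs n
  have hm : Measurable π := hfac.continuous.measurable
  have hmap := hμ.map hm hfac.equivariant fun g =>
    (Odometer.continuous_smul g).measurable
  set C : Set (orbitClosure η) := π ⁻¹' Odometer.cylinder n ((1 : G) : G ⧸ Γ n) with hC
  have hCm : MeasurableSet C := hm (Odometer.isOpen_cylinder n _).measurableSet
  have hCμ : μ C = ((Γ n).index : ENNReal)⁻¹ := by
    rw [← Odometer.measure_cylinder hmap (hη.finiteIndex n) ((1 : G) : G ⧸ Γ n),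
      Measure.map_apply hm (Odometer.isOpen_cylinder n _).measurableSet]
  -- If `x` lies over `g Γ n` and `g⁻¹ ∈ j Γ n`, then `j • x` lies over the identity coset and
  -- carries the symbol of `x` at `1` to `j`.
  let E : G → Set (orbitClosure η) := fun j => C ∩ {y | y.1 j = 1}
  have hEm : ∀ j, MeasurableSet (E j) := fun j => hCm.inter (measurableSet_apply_eq j 1)
  have hsub : {x : orbitClosure η | x.1 1 = 1 ∧ 1 ∉ per x.1 (Γ n) 1} ⊆
      ⋃ j ∈ F, (fun y => j⁻¹ • y) '' E j := by
    rintro x ⟨hx1, hxp⟩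
    obtain ⟨g, hg⟩ := QuotientGroup.mk_surjective ((π x).1 n)
    have hxg := (hπ x n g).1 hg.symm
    obtain ⟨j, hj, hjg⟩ := hF g⁻¹ fun α hα => by
      have h1 : (1 : G) ∈ per x.1 (Γ n) α := by rwa [hη.mem_per_iff hxg, mul_one]
      have h2 : x.1 1 = α := by simpa using h1 1 (Γ n).one_mem
      rw [hx1] at h2
      exact hxp (h2 ▸ h1)
    refine Set.mem_biUnion hj ⟨j • x, ⟨?_, ?_⟩, by simp⟩
    · refine (hπ (j • x) n 1).2 ?_
      rw [cosetClosure_congr (g' := j * g)]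
      · exact shift_mem_cosetClosure_mul hxg j
      · rw [inv_one, one_mul, (hη.normal n).mem_comm_iff]
        simpa using (Γ n).inv_mem hjg
    · change x.1 (j⁻¹ * j) = 1
      rwa [inv_mul_cancel]
  calc μ {x | x.1 1 = 1 ∧ 1 ∉ per x.1 (Γ n) 1}
      ≤ μ (⋃ j ∈ F, (fun y => j⁻¹ • y) '' E j) := measure_mono hsub
    _ ≤ ∑ j ∈ F, μ ((fun y => j⁻¹ • y) '' E j) := measure_biUnion_finset_le _ _
    _ = ∑ j ∈ F, μ (E j) := Finset.sum_congr rfl fun j _ => hμ.invariant _ _ (hEm j)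
    _ = μ (⋃ j ∈ F, E j) := by
        refine (measure_biUnion_finset (fun i hi j hj hij => ?_) fun j _ => hEm j).symm
        refine Set.disjoint_left.2 fun y hyi hyj => hij ?_
        exact eq_of_mem_cosetClosure_of_sparse hF1 ((hπ y n 1).1 hyi.1) hi hj hyi.2 hyj.2
    _ ≤ μ C := measure_mono (Set.iUnion₂_subset fun j _ => Set.inter_subset_left)
    _ = _ := hCμ

/-- By countability and invariance it is enough to treat the position `1`, where the bound of
`measure_le` tends to zero. -/
theorem IsPeriodStructure.measure_compl_periodicOnes [Countable G] (hη : IsPeriodStructure η Γ)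
    (hs : HasSparseOnes η Γ) (hindex : ∀ n, n ≤ (Γ n).index)
    {μ : Measure (orbitClosure η)} (hμ : IsInvariantMeasure G μ) :
    μ (periodicOnes η Γ)ᶜ = 0 := by
  let N : G → Set (orbitClosure η) := fun p => {x | x.1 p = 1 ∧ ∀ n, p ∉ per x.1 (Γ n) 1}
  have hN1 : μ (N 1) = 0 := by
    refine le_antisymm (ge_of_tendsto' ENNReal.tendsto_inv_nat_nhds_zero fun n => ?_) zero_le
    calc μ (N 1) ≤ μ {x | x.1 1 = 1 ∧ 1 ∉ per x.1 (Γ n) 1} :=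
          measure_mono fun x hx => ⟨hx.1, hx.2 n⟩
      _ ≤ ((Γ n).index : ENNReal)⁻¹ := hη.measure_le hs hμ n
      _ ≤ (n : ENNReal)⁻¹ := ENNReal.inv_le_inv.2 (by exact_mod_cast hindex n)
  have hN1m : MeasurableSet (N 1) := by
    have : N 1 = {x | x.1 1 = 1} ∩ ⋂ n, {x : orbitClosure η | 1 ∈ per x.1 (Γ n) 1}ᶜ := by
      ext x
      simp [N]
    rw [this]
    exact (measurableSet_apply_eq 1 1).inter
      (MeasurableSet.iInter fun n => (measurableSet_mem_per _ 1 1).compl)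
  have hsub : (periodicOnes η Γ)ᶜ ⊆ ⋃ p : G, (fun x => p • x) '' N 1 := by
    intro x hx
    simp only [periodicOnes, Set.mem_compl_iff, Set.mem_ofPred_eq] at hx
    push Not at hx
    obtain ⟨p, hp, hpn⟩ := hx
    refine Set.mem_iUnion.2 ⟨p, p⁻¹ • x, ⟨?_, fun n hn => hpn n ?_⟩, by simp⟩
    · simpa [coe_smul_orbitClosure, shift] using hp
    · rw [coe_smul_orbitClosure, mem_per_shift (hη.normal n)] at hn
      simpa using hn
  refine measure_mono_null hsub (measure_iUnion_null fun p => ?_)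
  rw [hμ.invariant p _ hN1m, hN1]

end Conjugacy

/-! ### The array satisfies the abstract conditions. -/

section Array

variable {Γ : ℕ → Subgroup G} {D : ℕ → Finset G} {enum h : ℕ → ℕ → G}

theorem card_eq_index (hΓ : IsFundamentalSequence Γ D) {n : ℕ} (hn : 1 ≤ n) :
    (D n).card = (Γ n).index := by
  rw [Subgroup.index, ← Nat.card_eq_finsetCard]
  refine Nat.card_eq_of_bijective (fun d : D n => ((d : G) : G ⧸ Γ n)) ⟨fun d e hde => ?_, ?_⟩
  · exact Subtype.ext (hΓ.eq_of_mem hn d.2 e.2 (QuotientGroup.eq.1 hde))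
  · intro c
    obtain ⟨g, rfl⟩ := QuotientGroup.mk_surjective c
    obtain ⟨d, ⟨hd, hdg⟩, -⟩ := hΓ.existsUnique_mem_coset n hn g
    exact ⟨⟨d, hd⟩, QuotientGroup.eq.2 hdg⟩

theorem isPeriodStructure_array (hΓ : IsFundamentalSequence Γ D) (hD : IsRapidlyGrowing D)
    (hh : IsChoice Γ D enum h) : IsPeriodStructure (array Γ D h) fun n => Γ (n + 1) where
  normal n := hΓ.normal (n + 1) (by omega)
  finiteIndex n := hΓ.finiteIndex (n + 1) (by omega)
  antitone := fun a b hab => hΓ.le_of_le (by omega) (by omega)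
  exists_mem_per x := by
    obtain ⟨n, hn, hx⟩ := exists_mem_per_array (h := h) hΓ x
    exact ⟨n - 1, by rwa [Nat.sub_add_cancel hn]⟩
  essential n u hu := mem_of_per_subset hΓ hD hh (by omega) hu

theorem hasSparseOnes_array (hΓ : IsFundamentalSequence Γ D) (hD : IsRapidlyGrowing D)
    (hh : IsChoice Γ D enum h) : HasSparseOnes (array Γ D h) fun n => Γ (n + 1) := by
  classical
  intro n
  -- The finite set is `J (n + 1)`, cut out of `D (n + 1)` to be a `Finset`.
  refine ⟨(D (n + 1)).filter (· ∈ J Γ D (n + 1)), fun x hx => ?_, fun γ hγ i hi j hj => ?_⟩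
  · obtain ⟨d, hd, hdx⟩ := exists_mem_J_of_mem_hole hΓ (by omega)
      ((mem_hole_iff_forall_notMem_per hΓ hD hh (by omega)).2 hx)
    exact ⟨d, Finset.mem_filter.2 ⟨J_subset (by omega) hd, hd⟩, hdx⟩
  · exact eq_of_array_eq_one hΓ (by omega) hγ (Finset.mem_filter.1 hi).2 (Finset.mem_filter.1 hj).2

end Array

end Toeplitz

theorem proposition5 {G : Type*} [Group G] [Countable G] [Infinite G]
    (Γ : ℕ → Subgroup G) (D : ℕ → Finset G) (enum h : ℕ → ℕ → G)
    (hΓ : Toeplitz.IsFundamentalSequence Γ D)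
    (hD : Toeplitz.IsRapidlyGrowing D)
    (hh : Toeplitz.IsChoice Γ D enum h)
    (hlink : Toeplitz.IsLinked Γ D h) :
    ∃ π : Toeplitz.orbitClosure (Toeplitz.array Γ D h) →
        Toeplitz.Odometer (fun n => Γ (n + 1)),
      Toeplitz.IsCanonicalMap (Toeplitz.array Γ D h) (fun n => Γ (n + 1)) π ∧
      (∀ μ' : MeasureTheory.Measure (Toeplitz.orbitClosure (Toeplitz.array Γ D h)),
        Toeplitz.IsInvariantMeasure G μ' →
        ∃ ν : MeasureTheory.Measure (Toeplitz.Odometer (fun n => Γ (n + 1))),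
          Toeplitz.IsInvariantMeasure G ν ∧
          (∀ ν' : MeasureTheory.Measure (Toeplitz.Odometer (fun n => Γ (n + 1))),
            Toeplitz.IsInvariantMeasure G ν' → ν' = ν) ∧
          Toeplitz.IsMeasureConjugacy G π μ' ν) ∧
      ∃ A : Set (Toeplitz.orbitClosure (Toeplitz.array Γ D h)),
        MeasurableSet A ∧ Toeplitz.IsInvariantSet G A ∧ Set.InjOn π A ∧
        ∀ μ' : MeasureTheory.Measure (Toeplitz.orbitClosure (Toeplitz.array Γ D h)),
          Toeplitz.IsInvariantMeasure G μ' → μ' A = 1 := by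
  open Toeplitz in
  have hη := isPeriodStructure_array hΓ hD hh
  have hnull := fun μ' hμ' => hη.measure_compl_periodicOnes (hasSparseOnes_array hΓ hD hh)
    (fun n => by
      rw [← card_eq_index hΓ (by omega)]
      exact (Nat.le_succ n).trans (le_card hΓ hD (by omega))) (μ := μ') hμ'
  obtain ⟨π, hπ⟩ := hη.exists_isCanonicalMap
  have hfac := hη.isFactorMap hπ
  have hinj := hη.injOn_periodicOnes hπ
  have hinv := hη.isInvariantSet_periodicOnes
  refine ⟨π, hπ, fun μ' hμ' => ?_, _, measurableSet_periodicOnes, hinv, hinj, fun μ' hμ' => ?_⟩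
  · have hν := hμ'.map hfac.continuous.measurable hfac.equivariant fun g =>
      (Odometer.continuous_smul g).measurable
    have : SecondCountableTopology (Odometer fun n => Γ (n + 1)) :=
      Odometer.secondCountableTopology
    have : StandardBorelSpace (orbitClosure (array Γ D h)) :=
      isClosed_closure.measurableSet.standardBorel
    exact ⟨_, hν, fun ν' hν' => Odometer.eq_of_isInvariantMeasure hη.finiteIndex hν hν',
      hfac.isMeasureConjugacy measurableSet_periodicOnes hinv hinj (hnull μ' hμ')⟩
  · have := hμ'.isProbabilityMeasure
    exact (prob_compl_eq_zero_iff measurableSet_periodicOnes).1 (hnull μ' hμ')
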